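/- For $n\ge 1$ let Median of size $n$ be the following two-party communication problem: Alice holds a set $A\subseteq\{1,\dots,n\}$, Bob holds a set $B\subseteq\{1,\dots,n\}$, not both empty, and they have to determine the median of the multiset union of $A$ and $B$, that is, its $\lceil t/2\rceil$-th smallest element, where $t=|A|+|B|$. In a deterministic protocol the players exchange bit strings; one round consists of one message sent by one player; the messages exchanged so far determine who speaks next and whether the protocol halts, each message depends only on the earlier messages and the sender's own input, and at the end the output is determined by the messages exchanged. Theorem. Let $\varepsilon>0$. There are no functions $r,b:\mathbb N\to\mathbb N$ with $r(n)=O(\log^{1-\varepsilon} n)$ and $b(n)=O(\log n)$ as $n\to\infty$ such that for every $n\ge 1$ Median of size $n$ is solved by a deterministic protocol that, on every input, uses at most $r(n)$ rounds and communicates at most $b(n)$ bits in each round. -/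

import Mathlib

open Filter Asymptotics

/-- Deterministic two-party protocols: Alice holds an input in `X`, Bob an input in `Y`, and the
protocol produces a value in `Z`. At every point the history of messages determines who speaks
next. The speaker sends a bit string that depends only on the history and on the speaker's own
input, and the protocol continues according to the string sent. When the protocol halts, the
output is determined by the history, so that both players know it. -/
inductive Protocol (X Y Z : Type) : Type where
  | halt (z : Z) : Protocol X Y Z
  | alice (msg : X → List Bool) (next : List Bool → Protocol X Y Z) : Protocol X Y Z
  | bob (msg : Y → List Bool) (next : List Bool → Protocol X Y Z) : Protocol X Y Z

namespace Protocol

variable {X Y Z : Type}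

/-- The output of the protocol on the input pair `(x, y)`. -/
def output : Protocol X Y Z → X → Y → Z
  | halt z, _, _ => z
  | alice msg next, x, y => (next (msg x)).output x y
  | bob msg next, x, y => (next (msg y)).output x y

/-- The list of messages exchanged on the input pair `(x, y)`, in the order of sending. Each
message is one round, and its length is the number of bits communicated in that round. -/
def transcript : Protocol X Y Z → X → Y → List (List Bool)
  | halt _, _, _ => []
  | alice msg next, x, y => msg x :: (next (msg x)).transcript x y
  | bob msg next, x, y => msg y :: (next (msg y)).transcript x y

/-- The number of rounds used on the input pair `(x, y)`. -/
def rounds (P : Protocol X Y Z) (x : X) (y : Y) : ℕ := (P.transcript x y).length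

end Protocol

/-- The median of the multiset union of `A` and `B`: if this multiset has `t ≥ 1` elements, its
median is the `⌈t / 2⌉`-th smallest one (position `(t - 1) / 2` of the sorted list, counted
from zero). It is `none` if both sets are empty. The type `Fin n` plays the role of
the ordered universe `{1, …, n}`. -/
def median {n : ℕ} (A B : Finset (Fin n)) : Option (Fin n) :=
  ((A.val + B.val).sort (· ≤ ·))[(A.card + B.card - 1) / 2]?

/-- The problem Median of size `n` (Alice holds `A`, Bob holds `B`, subsets of an `n`-element
ordered universe that are not both empty; find the median of their multiset union) is solved by
a deterministic protocol that uses at most `r` rounds and, in each round, at most `b` bits. -/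
def MedianHasProtocol (n r b : ℕ) : Prop :=
  ∃ P : Protocol (Finset (Fin n)) (Finset (Fin n)) (Fin n),
    ∀ A B : Finset (Fin n), (A ∪ B).Nonempty →
      median A B = some (P.output A B) ∧
      P.rounds A B ≤ r ∧
      ∀ m ∈ P.transcript A B, m.length ≤ b

/-!
The lower bound comes from pointer jumping on the complete `k`-ary tree of depth `d`, whose inner
nodes on even levels belong to one player and those on odd levels to the other. Each node has a
pointer to one of its children, known to its owner, and the players look for the leaf at the
end of the path from the root.

*Pointer jumping is a median problem* (`PointerJumping.median_encodeFin`). Reserve an interval of the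
universe for each node. If all subtrees at the next level carry the same number `w` of elements,
whatever the inputs are, then the owner of the node puts multiples of `w` elements at both ends of
the interval so that the median of the interval is the median of the subtree chosen by the pointer.
One level costs a factor `3 * k` in the size of the universe, so `(3 * k) ^ d ≤ n` suffices.

*Pointer jumping needs `d` rounds* if `k` is at least `8 * b + 17`, where `b` is the number of bits
per round (`PointerJumping.not_solvesOn`). An adversary keeps a rectangle of inputs in which the
owner of the current root has density at least `1 / 2` and the other player density at least
`2 ^ (-(b + 3))`. The other player has independent inputs for the `k` subtrees, so the information
given away by a few messages is small for most of them, and the pointer can still lead to such a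
subtree (`exists_child`). There the players exchange their roles, and the invariant is restored at
the price of one level for each round.

With `b = O(log n)`, `k = 8 * b + 17` and `d = r + 1`, the condition `(3 * k) ^ d ≤ n` reads
`(r + 1) * log (24 * b + 51) ≤ log n`, which holds for large `n` if `r = O(log n ^ (1 - ε))`
(`eventually_pow_le`), since the second factor is `O(log (log n))`.
-/

open Finset

/-! ### Transformations of protocols -/

namespace Protocol

variable {X Y Z X' Y' : Type}

/-- The protocol with the roles of the two players exchanged. -/
def swap : Protocol X Y Z → Protocol Y X Z
  | halt z => halt z
  | alice msg next => bob msg fun m => (next m).swap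
  | bob msg next => alice msg fun m => (next m).swap

theorem output_swap (P : Protocol X Y Z) (x : X) (y : Y) :
    P.swap.output y x = P.output x y := by
  induction P with
  | halt z => rfl
  | alice msg next ih => exact ih _
  | bob msg next ih => exact ih _

theorem transcript_swap (P : Protocol X Y Z) (x : X) (y : Y) :
    P.swap.transcript y x = P.transcript x y := by
  induction P with
  | halt z => rfl
  | alice msg next ih => exact congrArg _ (ih _)
  | bob msg next ih => exact congrArg _ (ih _)

/-- The protocol in which each player first translates the own input and then runs `P`. -/
def comap (f : X' → X) (g : Y' → Y) : Protocol X Y Z → Protocol X' Y' Z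
  | halt z => halt z
  | alice msg next => alice (msg ∘ f) fun m => (next m).comap f g
  | bob msg next => bob (msg ∘ g) fun m => (next m).comap f g

theorem output_comap (f : X' → X) (g : Y' → Y) (P : Protocol X Y Z) (x : X') (y : Y') :
    (P.comap f g).output x y = P.output (f x) (g y) := by
  induction P with
  | halt z => rfl
  | alice msg next ih => exact ih _
  | bob msg next ih => exact ih _

theorem transcript_comap (f : X' → X) (g : Y' → Y) (P : Protocol X Y Z) (x : X') (y : Y') :
    (P.comap f g).transcript x y = P.transcript (f x) (g y) := by
  induction P with
  | halt z => rfl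
  | alice msg next ih => exact congrArg _ (ih _)
  | bob msg next ih => exact congrArg _ (ih _)

end Protocol

/-! ### Counting -/

/-- The number whose binary digits are those of the string, preceded by a leading one. -/
def bitCode : List Bool → ℕ
  | [] => 1
  | c :: l => 2 * bitCode l + c.toNat

theorem bitCode_pos (l : List Bool) : 0 < bitCode l := by
  induction l with
  | nil => exact one_pos
  | cons c l ih => simp only [bitCode]; omega

theorem bitCode_lt (l : List Bool) : bitCode l < 2 ^ (l.length + 1) := by
  induction l with
  | nil => simp [bitCode]
  | cons c l ih =>
    have := c.toNat_lt
    simp only [bitCode, List.length_cons, pow_succ] at *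
    omega

theorem bitCode_injective : Function.Injective bitCode := by
  intro l
  induction l with
  | nil =>
    rintro (_ | ⟨c, l⟩) h
    · rfl
    · have := bitCode_pos l
      simp only [bitCode] at h
      omega
  | cons c l ih =>
    rintro (_ | ⟨c', l'⟩) h
    · have := bitCode_pos l
      simp only [bitCode] at h
      omega
    · simp only [bitCode] at h
      have h1 := c.toNat_lt
      have h2 := c'.toNat_lt
      rw [ih (show bitCode l = bitCode l' by omega),
        (show Function.Injective Bool.toNat by decide) (show c.toNat = c'.toNat by omega)]

theorem card_le_of_length_le {b : ℕ} (M : Finset (List Bool)) (h : ∀ m ∈ M, m.length ≤ b) :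
    #M ≤ 2 ^ (b + 1) := by
  calc #M ≤ #(range (2 ^ (b + 1))) := by
        refine card_le_card_of_injOn bitCode (fun m hm => ?_) bitCode_injective.injOn
        rw [coe_range, Set.mem_Iio]
        exact (bitCode_lt m).trans_le (Nat.pow_le_pow_right two_pos (Nat.succ_le_succ (h m hm)))
    _ = 2 ^ (b + 1) := card_range _

open Classical in
/-- A message of at most `b` bits can be fixed so that the views that remain possible are at
least a `2 ^ (-(b + 1))` fraction of the views that were possible before. -/
theorem exists_message {X V : Type} {b : ℕ} (S : Finset X) (msg : X → List Bool) (view : X → V)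
    (h : ∀ x ∈ S, (msg x).length ≤ b) :
    ∃ m, #(S.image view) ≤ 2 ^ (b + 1) * #({x ∈ S | msg x = m}.image view) := by
  rcases S.eq_empty_or_nonempty with rfl | hS
  · exact ⟨[], by simp⟩
  obtain ⟨m, -, hm⟩ := exists_max_image (S.image msg)
    (fun m => #({x ∈ S | msg x = m}.image view)) (hS.image _)
  refine ⟨m, ?_⟩
  have hsub : S.image view ⊆ (S.image msg).biUnion fun m => {x ∈ S | msg x = m}.image view := by
    intro v hv
    obtain ⟨x, hx, rfl⟩ := mem_image.1 hv
    exact mem_biUnion.2 ⟨msg x, mem_image_of_mem _ hx,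
      mem_image_of_mem _ (mem_filter.2 ⟨hx, rfl⟩)⟩
  calc _ ≤ _ := card_le_card hsub
    _ ≤ #(S.image msg) * _ := card_biUnion_le_card_mul _ _ _ hm
    _ ≤ _ := Nat.mul_le_mul_right _ (card_le_of_length_le _ (by
        intro m hm
        obtain ⟨x, hx, rfl⟩ := mem_image.1 hm
        exact h x hx))

section Projections

variable {k : ℕ} {U V : Type}

open Classical in
theorem card_le_prod_card_image_eval (F : Finset (Fin k → V)) :
    #F ≤ ∏ j, #(F.image fun f => f j) := by
  rw [← Fintype.card_piFinset]
  exact card_le_card fun f hf => Fintype.mem_piFinset.2 fun j => mem_image_of_mem _ hf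

variable [Fintype U] [Fintype V]

open Classical in
theorem card_mul_card_le (F : Finset (Fin k → V)) (i : Fin k) :
    #F * Fintype.card V ≤ #(F.image fun f => f i) * Fintype.card V ^ k := by
  have h : ∏ j ∈ univ.erase i, #(F.image fun f => f j) ≤ Fintype.card V ^ (k - 1) := by
    calc _ ≤ ∏ j ∈ univ.erase i, Fintype.card V := prod_le_prod' fun j _ => card_le_univ _
      _ = _ := by simp [card_erase_of_mem]
  obtain ⟨m, rfl⟩ : ∃ m, k = m + 1 := ⟨k - 1, by have := i.2; omega⟩
  calc #F * Fintype.card V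
      ≤ (#(F.image fun f => f i) * Fintype.card V ^ m) * Fintype.card V := by
        refine Nat.mul_le_mul_right _ ((card_le_prod_card_image_eval F).trans ?_)
        rw [← mul_prod_erase univ _ (mem_univ i)]
        exact Nat.mul_le_mul_left _ h
    _ = _ := by rw [pow_succ, mul_assoc]

open Classical in
/-- If `T` is a `2 ^ (-c)` fraction of a `k`-th power, then at most `c` of its projections to the
coordinates fill less than half of the factor. -/
theorem card_small_projections_le [Nonempty V] {c : ℕ} (T : Finset (Fin k → V))
    (hT : Fintype.card V ^ k ≤ 2 ^ c * #T) :
    #{j | 2 * #(T.image fun f => f j) < Fintype.card V} ≤ c := by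
  set J : Finset (Fin k) := {j | 2 * #(T.image fun f => f j) < Fintype.card V} with hJ
  have hV : 0 < Fintype.card V := Fintype.card_pos
  have hTpos : 0 < #T := by
    rcases Nat.eq_zero_or_pos #T with h | h
    · rw [h, mul_zero] at hT
      exact absurd hT (Nat.not_le.2 (pow_pos hV k))
    · exact h
  have h1 : 2 ^ #J * #T ≤ Fintype.card V ^ k := by
    calc 2 ^ #J * #T ≤ (∏ j, if j ∈ J then 2 else 1) * ∏ j, #(T.image fun f => f j) := by
          refine Nat.mul_le_mul (le_of_eq ?_) (card_le_prod_card_image_eval T)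
          rw [prod_ite_mem, univ_inter, prod_const]
      _ = ∏ j, (if j ∈ J then 2 else 1) * #(T.image fun f => f j) := prod_mul_distrib.symm
      _ ≤ ∏ _j : Fin k, Fintype.card V := by
          refine prod_le_prod' fun j _ => ?_
          split_ifs with h
          · exact (mem_filter.1 h).2.le
          · rw [one_mul]; exact card_le_univ _
      _ = _ := by simp
  exact (Nat.pow_le_pow_iff_right one_lt_two).1
    (Nat.le_of_mul_le_mul_right (h1.trans hT) hTpos)

open Classical in
/-- The descent to a child: if the owner of the root has at least half of all inputs left and the
other player a `2 ^ (-c)` fraction with `4 * c < k`, then for some child `i` to which the root may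
still point, the other player has at least half, and the owner of the root at least a quarter of
all inputs left for the subtree at `i`. -/
theorem exists_child [Nonempty U] [Nonempty V] {c : ℕ} (hc : 4 * c < k)
    (S : Finset (Fin k × (Fin k → U))) (T : Finset (Fin k → V))
    (hS : k * Fintype.card U ^ k ≤ 2 * #S) (hT : Fintype.card V ^ k ≤ 2 ^ c * #T) :
    ∃ i, Fintype.card V ≤ 2 * #(T.image fun f => f i) ∧
      Fintype.card U ≤ 4 * #({s ∈ S | s.1 = i}.image fun s => s.2 i) := by
  by_contra! hcon
  have hU : 0 < Fintype.card U := Fintype.card_pos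
  set J : Finset (Fin k) := {j | 2 * #(T.image fun f => f j) < Fintype.card V} with hJ
  have hJc : #J ≤ c := card_small_projections_le T hT
  have hcard : #S = ∑ i, #{s ∈ S | s.1 = i} :=
    card_eq_sum_card_fiberwise fun s _ => mem_coe.2 (mem_univ s.1)
  have himg : ∀ i, #{s ∈ S | s.1 = i} = #({s ∈ S | s.1 = i}.image Prod.snd) := fun i =>
    (card_image_of_injOn fun s hs s' hs' h => Prod.ext
      ((mem_filter.1 hs).2.trans (mem_filter.1 hs').2.symm) h).symm
  have hterm : ∀ i, 4 * #{s ∈ S | s.1 = i} ≤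
      Fintype.card U ^ k + if i ∈ J then 3 * Fintype.card U ^ k else 0 := by
    intro i
    rw [himg]
    split_ifs with hi
    · have : #({s ∈ S | s.1 = i}.image Prod.snd) ≤ Fintype.card U ^ k := by
        refine (card_le_univ _).trans (le_of_eq ?_)
        simp
      omega
    · have h1 := card_mul_card_le ({s ∈ S | s.1 = i}.image Prod.snd) i
      have h2 := hcon i (by simpa [hJ] using hi)
      rw [image_image, show (fun f : Fin k → U => f i) ∘ Prod.snd =
        fun s : Fin k × (Fin k → U) => s.2 i from rfl] at h1
      have h3 : (4 * #({s ∈ S | s.1 = i}.image Prod.snd)) * Fintype.card U ≤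
          Fintype.card U ^ k * Fintype.card U := by
        calc _ = 4 * (#({s ∈ S | s.1 = i}.image Prod.snd) * Fintype.card U) := by ring
          _ ≤ 4 * _ := Nat.mul_le_mul_left 4 h1
          _ = Fintype.card U ^ k * (4 * _) := by ring
          _ ≤ _ := Nat.mul_le_mul_left _ h2.le
      simpa using Nat.le_of_mul_le_mul_right h3 hU
  have hsum : 4 * #S ≤ k * Fintype.card U ^ k + c * (3 * Fintype.card U ^ k) := by
    calc 4 * #S = ∑ i, 4 * #{s ∈ S | s.1 = i} := by rw [hcard, mul_sum]
      _ ≤ ∑ i, (Fintype.card U ^ k + if i ∈ J then 3 * Fintype.card U ^ k else 0) :=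
          sum_le_sum fun i _ => hterm i
      _ = k * Fintype.card U ^ k + #J * (3 * Fintype.card U ^ k) := by
          rw [sum_add_distrib, sum_ite_mem, univ_inter]; simp
      _ ≤ _ := by gcongr
  have hpos : 0 < Fintype.card U ^ k := pow_pos hU k
  have : (4 * c + 1) * Fintype.card U ^ k ≤ k * Fintype.card U ^ k := by gcongr; omega
  nlinarith

end Projections

/-! ### Pointer jumping on a tree -/

namespace PointerJumping

/-- The inputs of the two players for pointer jumping on the complete `k`-ary tree of depth `d`.
The inner nodes on even levels belong to the owner of the root (the flag is `true`), those on odd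
levels to the other player (the flag is `false`), and the input of a player consists of a pointer
to a child for each own node. A player who owns the root owns none of the roots of the
subtrees at the next level, and vice versa. -/
def Input (k : ℕ) : ℕ → Bool → Type
  | 0, _ => Unit
  | d + 1, true => Fin k × (Fin k → Input k d false)
  | d + 1, false => Fin k → Input k d true

/-- The leaves of the complete `k`-ary tree of depth `d`. -/
def Leaf (k : ℕ) : ℕ → Type
  | 0 => Unit
  | d + 1 => Fin k × Leaf k d

/-- The leaf that is reached from the root along the pointers; `x` is the input of the owner of
the root. -/
def leaf {k : ℕ} : (d : ℕ) → (x : Input k d true) → (y : Input k d false) → Leaf k d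
  | 0, _, _ => ()
  | d + 1, x, y => (x.1, leaf d (y x.1) (x.2 x.1))

noncomputable instance instFintypeInput (k : ℕ) : (d : ℕ) → (s : Bool) → Fintype (Input k d s)
  | 0, _ => inferInstanceAs (Fintype Unit)
  | d + 1, true =>
    haveI := instFintypeInput k d false
    inferInstanceAs (Fintype (Fin k × (Fin k → Input k d false)))
  | d + 1, false =>
    haveI := instFintypeInput k d true
    inferInstanceAs (Fintype (Fin k → Input k d true))

theorem nonempty_input {k : ℕ} (hk : 0 < k) : ∀ (d : ℕ) (s : Bool), Nonempty (Input k d s)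
  | 0, _ => ⟨()⟩
  | d + 1, true => (nonempty_input hk d false).elim fun x => ⟨(⟨0, hk⟩, fun _ => x)⟩
  | d + 1, false => (nonempty_input hk d true).elim fun y => ⟨fun _ => y⟩

theorem card_input_succ_true (k d : ℕ) :
    Fintype.card (Input k (d + 1) true) = k * Fintype.card (Input k d false) ^ k := by
  have : Fintype.card (Input k (d + 1) true) =
    Fintype.card (Fin k × (Fin k → Input k d false)) := rfl
  rw [this]; simp

theorem card_input_succ_false (k d : ℕ) :
    Fintype.card (Input k (d + 1) false) = Fintype.card (Input k d true) ^ k := by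
  have : Fintype.card (Input k (d + 1) false) = Fintype.card (Fin k → Input k d true) := rfl
  rw [this]; simp

/-- `P` finds the leaf with at most `r` rounds of at most `b` bits on all pairs in `S × T`. Here
`α` and `β` give what the inputs of the players are for the tree under consideration, and `g`
is the encoding of its leaves as outputs. -/
def SolvesOn {k : ℕ} (b r d : ℕ) {X Y Z : Type} (P : Protocol X Y Z) (S : Finset X)
    (T : Finset Y) (α : X → Input k d true) (β : Y → Input k d false) (g : Leaf k d → Z) : Prop :=
  ∀ x ∈ S, ∀ y ∈ T, P.output x y = g (leaf d (α x) (β y)) ∧ (P.transcript x y).length ≤ r ∧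
    ∀ m ∈ P.transcript x y, m.length ≤ b

section Descent

variable {k b r d : ℕ} {X Y Z : Type} {S : Finset X} {T : Finset Y}

open Classical in
theorem SolvesOn.child {P : Protocol X Y Z} {α : X → Input k (d + 1) true}
    {β : Y → Input k (d + 1) false} {g : Leaf k (d + 1) → Z} (h : SolvesOn b r (d + 1) P S T α β g)
    (i : Fin k) :
    SolvesOn b r d P.swap T {x ∈ S | (α x).1 = i} (fun y => β y i) (fun x => (α x).2 i)
      fun l => g (i, l) := by
  intro y hy x hx
  obtain ⟨hxS, rfl⟩ := mem_filter.1 hx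
  rw [Protocol.output_swap, Protocol.transcript_swap]
  exact h x hxS y hy

open Classical in
theorem SolvesOn.alice {msg : X → List Bool} {next : List Bool → Protocol X Y Z}
    {α : X → Input k d true} {β : Y → Input k d false} {g : Leaf k d → Z}
    (h : SolvesOn b (r + 1) d (.alice msg next) S T α β g) (m : List Bool) :
    SolvesOn b r d (next m) {x ∈ S | msg x = m} T α β g := by
  intro x hx y hy
  obtain ⟨hxS, rfl⟩ := mem_filter.1 hx
  obtain ⟨h1, h2, h3⟩ := h x hxS y hy
  exact ⟨h1, Nat.le_of_succ_le_succ h2, fun m hm => h3 m (List.mem_cons_of_mem _ hm)⟩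

open Classical in
theorem SolvesOn.bob {msg : Y → List Bool} {next : List Bool → Protocol X Y Z}
    {α : X → Input k d true} {β : Y → Input k d false} {g : Leaf k d → Z}
    (h : SolvesOn b (r + 1) d (.bob msg next) S T α β g) (m : List Bool) :
    SolvesOn b r d (next m) S {y ∈ T | msg y = m} α β g := by
  intro x hx y hy
  obtain ⟨hyT, rfl⟩ := mem_filter.1 hy
  obtain ⟨h1, h2, h3⟩ := h x hx y hyT
  exact ⟨h1, Nat.le_of_succ_le_succ h2, fun m hm => h3 m (List.mem_cons_of_mem _ hm)⟩

open Classical in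
/-- `exists_child` for the views of the two players of a tree of depth `d + 1`. -/
theorem exists_child_view {c : ℕ} (hc : 4 * c < k) (S : Finset X) (T : Finset Y)
    (α : X → Input k (d + 1) true) (β : Y → Input k (d + 1) false)
    (hS : Fintype.card (Input k (d + 1) true) ≤ 2 * #(S.image α))
    (hT : Fintype.card (Input k (d + 1) false) ≤ 2 ^ c * #(T.image β)) :
    ∃ i, Fintype.card (Input k d true) ≤ 2 * #(T.image fun y => β y i) ∧
      Fintype.card (Input k d false) ≤
        4 * #({x ∈ S | (α x).1 = i}.image fun x => (α x).2 i) := by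
  have hk : 0 < k := by omega
  have := nonempty_input hk d true
  have := nonempty_input hk d false
  rw [card_input_succ_true] at hS
  rw [card_input_succ_false] at hT
  obtain ⟨i, h1, h2⟩ := exists_child (U := Input k d false) (V := Input k d true) hc
    (@Finset.image X (Fin k × (Fin k → Input k d false)) (fun _ _ => propDecidable _) α S)
    (@Finset.image Y (Fin k → Input k d true) (fun _ _ => propDecidable _) β T) hS hT
  refine ⟨i, h1.trans (Nat.mul_le_mul_left _ (card_le_card ?_)),
    h2.trans (Nat.mul_le_mul_left _ (card_le_card ?_))⟩
  · intro v hv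
    obtain ⟨f, hf, rfl⟩ := mem_image.1 hv
    obtain ⟨y, hy, rfl⟩ := (@mem_image _ _ (fun _ _ => propDecidable _) _ _ _).1 hf
    exact mem_image_of_mem (fun y => β y i) hy
  · intro u hu
    obtain ⟨s, hs, rfl⟩ := mem_image.1 hu
    obtain ⟨hs, hsi⟩ := mem_filter.1 hs
    obtain ⟨x, hx, rfl⟩ := (@mem_image _ _ (fun _ _ => propDecidable _) _ _ _).1 hs
    exact mem_image_of_mem (fun x => (α x).2 i) (mem_filter.2 ⟨hx, hsi⟩)

open Classical in
theorem exists_fst_ne (hk : 3 ≤ k) (S : Finset X) (α : X → Input k (d + 1) true)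
    (hS : Fintype.card (Input k (d + 1) true) ≤ 2 * #(S.image α)) :
    ∃ x ∈ S, ∃ x' ∈ S, (α x).1 ≠ (α x').1 := by
  by_contra! hcon
  have := nonempty_input (k := k) (by omega) d false
  have hpos : 0 < Fintype.card (Input k d false) ^ k := pow_pos Fintype.card_pos k
  have h1 : #(S.image α) ≤ Fintype.card (Fin k → Input k d false) := by
    refine (card_le_card_of_injOn (t := (univ : Finset (Fin k → Input k d false)))
      Prod.snd (fun _ _ => mem_coe.2 (mem_univ _)) ?_)
    intro s hs s' hs' h
    obtain ⟨x, hx, rfl⟩ := mem_image.1 (mem_coe.1 hs)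
    obtain ⟨x', hx', rfl⟩ := mem_image.1 (mem_coe.1 hs')
    exact Prod.ext (hcon x hx x' hx') h
  rw [Fintype.card_fun, Fintype.card_fin] at h1
  rw [card_input_succ_true] at hS
  have : 3 * Fintype.card (Input k d false) ^ k ≤ k * Fintype.card (Input k d false) ^ k := by
    gcongr
  omega

open Classical in
theorem nonempty_of_card_input_le {s : Bool} {β : Y → Input k d s} {c : ℕ} (hk : 0 < k)
    (hT : Fintype.card (Input k d s) ≤ c * #(T.image β)) : T.Nonempty := by
  have := nonempty_input hk d s
  by_contra hT0
  rw [not_nonempty_iff_eq_empty.1 hT0] at hT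
  simp at hT

open Classical in
/-- A protocol that halts at once has a constant output, but the owner of the root still has
inputs with different pointers at the root. -/
theorem not_solvesOn_halt (hk : 3 ≤ k) {α : X → Input k (d + 1) true}
    {β : Y → Input k (d + 1) false} {g : Leaf k (d + 1) → Z} {c : ℕ}
    (hS : Fintype.card (Input k (d + 1) true) ≤ 2 * #(S.image α))
    (hT : Fintype.card (Input k (d + 1) false) ≤ c * #(T.image β))
    (hg : Function.Injective g) (z : Z) : ¬ SolvesOn b r (d + 1) (.halt z) S T α β g := by
  intro h
  obtain ⟨x, hx, x', hx', hne⟩ := exists_fst_ne hk S α hS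
  obtain ⟨y, hy⟩ := nonempty_of_card_input_le (by omega) hT
  have hl : leaf (d + 1) (α x) (β y) = leaf (d + 1) (α x') (β y) :=
    hg ((h x hx y hy).1.symm.trans (h x' hx' y hy).1)
  exact hne (Prod.ext_iff.1 hl).1

end Descent

open Classical in
/-- The round lower bound: fewer than `d` rounds of `b` bits do not solve pointer jumping of depth
`d` if the degree is large compared with `b`, even if the owner of the root is known to have an
input from a set of density `1 / 2` and the other player from a set of density
`2 ^ (-(b + 3))`. In a round in which the owner of the root speaks, first a child is fixed, so that
the speaker is the one whose set may become sparse; in a round in which the other player speaks,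
the message is fixed first, and the passage to a child makes the set of the speaker dense again. -/
theorem not_solvesOn {k b : ℕ} (hk : 8 * b + 17 ≤ k) (r : ℕ) : ∀ (d : ℕ), r < d →
    ∀ {X Y Z : Type} (P : Protocol X Y Z) (S : Finset X) (T : Finset Y) (α : X → Input k d true)
      (β : Y → Input k d false) (g : Leaf k d → Z), Function.Injective g →
      Fintype.card (Input k d true) ≤ 2 * #(S.image α) →
      Fintype.card (Input k d false) ≤ 2 ^ (b + 3) * #(T.image β) →
      ¬ SolvesOn b r d P S T α β g := by
  induction r with
  | zero =>
    intro d hd X Y Z P S T α β g hg hS hT h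
    obtain ⟨d, rfl⟩ : ∃ e, d = e + 1 := ⟨d - 1, by omega⟩
    obtain ⟨x, hx, -⟩ := exists_fst_ne (by omega) S α hS
    obtain ⟨y, hy⟩ := nonempty_of_card_input_le (by omega) hT
    have h2 := (h x hx y hy).2.1
    cases P with
    | halt z => exact not_solvesOn_halt (by omega) hS hT hg z h
    | alice msg next => simp [Protocol.transcript] at h2
    | bob msg next => simp [Protocol.transcript] at h2
  | succ r ih =>
    intro d hd X Y Z P S T α β g hg hS hT h
    obtain ⟨d, rfl⟩ : ∃ e, d = e + 1 := ⟨d - 1, by omega⟩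
    have hrd : r < d := by omega
    have hk0 : 0 < k := by omega
    have hginj : ∀ i : Fin k, Function.Injective fun l : Leaf k d => g (i, l) := fun i l l' hl =>
      congrArg Prod.snd (hg hl)
    cases P with
    | halt z => exact not_solvesOn_halt (by omega) hS hT hg z h
    | alice msg next =>
      obtain ⟨i, hi1, hi2⟩ := exists_child_view (c := b + 3) (by omega) S T α β hS hT
      have hc := h.child i
      obtain ⟨y, hy⟩ := nonempty_of_card_input_le hk0 hT
      obtain ⟨m, hm⟩ := exists_message {x ∈ S | (α x).1 = i} msg (fun x => (α x).2 i)
        (fun x hx => (h x (mem_filter.1 hx).1 y hy).2.2 _ List.mem_cons_self)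
      refine ih d hrd (next m).swap T _ _ _ _ (hginj i) hi1 ?_ (hc.bob m)
      calc _ ≤ _ := hi2
        _ ≤ 4 * _ := Nat.mul_le_mul_left 4 hm
        _ = _ := by ring
    | bob msg next =>
      obtain ⟨x, hx, -⟩ := exists_fst_ne (by omega) S α hS
      obtain ⟨m, hm⟩ := exists_message T msg β
        (fun y hy => (h x hx y hy).2.2 _ List.mem_cons_self)
      obtain ⟨i, hi1, hi2⟩ := exists_child_view (c := 2 * b + 4) (by omega) S
        {y ∈ T | msg y = m} α β hS (by
          calc _ ≤ _ := hT
            _ ≤ 2 ^ (b + 3) * _ := Nat.mul_le_mul_left _ hm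
            _ = _ := by ring)
      refine ih d hrd (next m).swap _ _ _ _ _ (hginj i) hi1 ?_ ((h.bob m).child i)
      refine hi2.trans (Nat.mul_le_mul_right _ ?_)
      calc 4 = 2 ^ 2 := rfl
        _ ≤ 2 ^ (b + 3) := Nat.pow_le_pow_right two_pos (by omega)

/-- A protocol for pointer jumping of depth `d` with messages of `b` bits has at least `d`
rounds if the degree is large compared with `b`. -/
theorem not_forall_rounds_le {k b r d : ℕ} (hk : 8 * b + 17 ≤ k) (hrd : r < d) {Z : Type}
    (P : Protocol (Input k d true) (Input k d false) Z) (g : Leaf k d → Z)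
    (hg : Function.Injective g) :
    ¬ ∀ x y, P.output x y = g (leaf d x y) ∧ P.rounds x y ≤ r ∧
      ∀ m ∈ P.transcript x y, m.length ≤ b := by
  classical
  intro h
  refine not_solvesOn hk r d hrd P univ univ id id g hg ?_ ?_ fun x _ y _ => h x y
  · rw [image_id, card_univ]; omega
  · rw [image_id, card_univ]
    exact Nat.le_mul_of_pos_left _ (by positivity)

end PointerJumping

/-! ### The median in terms of ranks -/

theorem List.getElem?_eq_some_of_countP {ι : Type*} [LinearOrder ι] {l : List ι}
    (hl : l.Pairwise (· ≤ ·)) {p : ι} {i : ℕ} (h1 : l.countP (· < p) ≤ i)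
    (h2 : i < l.countP (· ≤ p)) : l[i]? = some p := by
  induction l generalizing i with
  | nil => simp at h2
  | cons a l ih =>
    rw [List.pairwise_cons] at hl
    rw [List.countP_cons] at h1 h2
    cases i with
    | zero =>
      have hpa : p ≤ a := by
        by_contra h
        simp [not_le.1 h] at h1
      have hap : a ≤ p := by
        by_contra h
        simp only [h, decide_false, Bool.false_eq_true, if_false, add_zero,
          List.countP_pos_iff, decide_eq_true_eq] at h2
        obtain ⟨c, hc, hcp⟩ := h2
        exact h ((hl.1 c hc).trans hcp)
      simp [le_antisymm hap hpa]
    | succ i =>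
      rw [List.getElem?_cons_succ]
      by_cases hap : a < p
      · refine ih hl.2 ?_ ?_
        · simpa [hap] using h1
        · simpa [hap.le] using h2
      · have h3 : l.countP (· < p) = 0 := by
          rw [List.countP_eq_zero]
          intro c hc
          simpa using (not_lt.1 hap).trans (hl.1 c hc)
        refine ih hl.2 (by omega) ?_
        split_ifs at h2 <;> omega

/-- An element is the median if less than half of the multiset union lies strictly below it, and
more than half of it lies weakly below it. -/
theorem median_eq_some {n : ℕ} {A B : Finset (Fin n)} {p : Fin n}
    (h1 : 2 * (#{a ∈ A | a < p} + #{a ∈ B | a < p}) < #A + #B)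
    (h2 : #A + #B < 2 * (#{a ∈ A | a ≤ p} + #{a ∈ B | a ≤ p})) : median A B = some p := by
  have hcount : ∀ q : Fin n → Prop, ∀ [DecidablePred q],
      ((A.val + B.val).sort (· ≤ ·)).countP q = #{a ∈ A | q a} + #{a ∈ B | q a} := by
    intro q _
    rw [← Multiset.coe_countP, Multiset.sort_eq, Multiset.countP_add,
      Multiset.countP_eq_card_filter, Multiset.countP_eq_card_filter]
    rfl
  refine List.getElem?_eq_some_of_countP (Multiset.pairwise_sort _ _) ?_ ?_
  · rw [hcount]; omega
  · rw [hcount]; omega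

/-! ### Pointer jumping as a median problem -/

/-- The number of elements of `A` below `q`. -/
def rankBelow (A : Finset ℕ) (q : ℕ) : ℕ := #{a ∈ A | a < q}

theorem rankBelow_union {A B : Finset ℕ} (h : Disjoint A B) (q : ℕ) :
    rankBelow (A ∪ B) q = rankBelow A q + rankBelow B q := by
  rw [rankBelow, filter_union, card_union_of_disjoint (disjoint_filter_filter h)]
  rfl

theorem rankBelow_eq_card {A : Finset ℕ} {q : ℕ} (h : ∀ a ∈ A, a < q) : rankBelow A q = #A := by
  rw [rankBelow, filter_true_of_mem h]

theorem rankBelow_eq_zero {A : Finset ℕ} {q : ℕ} (h : ∀ a ∈ A, q ≤ a) : rankBelow A q = 0 := by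
  rw [rankBelow, filter_false_of_mem fun a ha => not_lt.2 (h a ha), card_empty]

theorem rankBelow_map_addLeft (A : Finset ℕ) (c q : ℕ) :
    rankBelow (A.map (addLeftEmbedding c)) (c + q) = rankBelow A q := by
  rw [rankBelow, filter_map, card_map, rankBelow]
  congr 1
  ext a
  simp

/-- The sets `A j`, `j < k`, side by side: they are moved to consecutive intervals of length `N`,
the first of which starts at `k * N`. -/
def blocks {k : ℕ} (N : ℕ) (A : Fin k → Finset ℕ) : Finset ℕ :=
  univ.biUnion fun j : Fin k => (A j).map (addLeftEmbedding (k * N + j * N))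

section Blocks

variable {k N : ℕ} {A : Fin k → Finset ℕ}

theorem mem_blocks {a : ℕ} : a ∈ blocks N A ↔ ∃ j : Fin k, ∃ c ∈ A j, k * N + j * N + c = a := by
  simp [blocks]

theorem le_of_mem_blocks {a : ℕ} (h : a ∈ blocks N A) : k * N ≤ a := by
  obtain ⟨j, c, -, rfl⟩ := mem_blocks.1 h
  omega

theorem lt_of_mem_blocks (hA : ∀ j, ∀ a ∈ A j, a < N) {a : ℕ} (h : a ∈ blocks N A) :
    a < 2 * (k * N) := by
  obtain ⟨j, c, hc, rfl⟩ := mem_blocks.1 h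
  have h1 := hA j c hc
  have h2 : (j + 1) * N ≤ k * N := Nat.mul_le_mul_right _ j.2
  linarith

theorem pairwiseDisjoint_blocks (hA : ∀ j, ∀ a ∈ A j, a < N) :
    ((univ : Finset (Fin k)) : Set (Fin k)).PairwiseDisjoint
      fun j => (A j).map (addLeftEmbedding (k * N + j * N)) := by
  have key : ∀ j j' : Fin k, j < j' → ∀ c ∈ A j, ∀ c', k * N + j * N + c ≠ k * N + j' * N + c' := by
    intro j j' hlt c hc c' h
    have h1 := hA j c hc
    have h2 : (j + 1 : ℕ) * N ≤ j' * N := Nat.mul_le_mul_right _ hlt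
    linarith
  intro j _ j' _ hne
  rw [Function.onFun, Finset.disjoint_left]
  intro a ha ha'
  simp only [Finset.mem_map, addLeftEmbedding_apply] at ha ha'
  obtain ⟨c, hc, rfl⟩ := ha
  obtain ⟨c', hc', h⟩ := ha'
  rcases lt_or_gt_of_ne hne with hlt | hlt
  · exact key j j' hlt c hc c' h.symm
  · exact key j' j hlt c' hc' c h

theorem card_blocks (hA : ∀ j, ∀ a ∈ A j, a < N) : #(blocks N A) = ∑ j, #(A j) := by
  rw [blocks, card_biUnion (pairwiseDisjoint_blocks hA)]
  simp

theorem rankBelow_blocks (hA : ∀ j, ∀ a ∈ A j, a < N) (i : Fin k) {q : ℕ} (hq : q ≤ N) :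
    rankBelow (blocks N A) (k * N + i * N + q) = ∑ j ∈ Iio i, #(A j) + rankBelow (A i) q := by
  have h1 : rankBelow (blocks N A) (k * N + i * N + q) = ∑ j : Fin k,
      rankBelow ((A j).map (addLeftEmbedding (k * N + j * N))) (k * N + i * N + q) := by
    rw [rankBelow, blocks, filter_biUnion, card_biUnion]
    · rfl
    · exact fun j hj j' hj' hne =>
        disjoint_filter_filter (pairwiseDisjoint_blocks hA hj hj' hne)
  rw [h1, ← sum_subset (subset_univ (Iic i)), ← Iio_insert, sum_insert (by simp),
    rankBelow_map_addLeft, add_comm]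
  · congr 1
    refine sum_congr rfl fun j hj => ?_
    have hji : (j + 1 : ℕ) * N ≤ i * N := Nat.mul_le_mul_right _ (mem_Iio.1 hj)
    rw [rankBelow_eq_card, card_map]
    intro a ha
    obtain ⟨c, hc, rfl⟩ := Finset.mem_map.1 ha
    have := hA j c hc
    rw [addLeftEmbedding_apply]
    linarith
  · intro j _ hj
    have hij : (i + 1 : ℕ) * N ≤ j * N :=
      Nat.mul_le_mul_right _ (not_le.1 fun h => hj (mem_Iic.2 h))
    refine rankBelow_eq_zero fun a ha => ?_
    obtain ⟨c, hc, rfl⟩ := Finset.mem_map.1 ha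
    rw [addLeftEmbedding_apply]
    linarith

end Blocks

namespace PointerJumping

variable {k : ℕ}

/-- The position of a leaf in the universe of size `(3 * k) ^ d`. The universe of depth `d + 1`
consists of `3 * k` intervals of length `(3 * k) ^ d`; the `k` intervals in the middle are the
universes for the subtrees, those to the left and to the right are padding. -/
def position : (d : ℕ) → Leaf k d → ℕ
  | 0, _ => 0
  | d + 1, l => k * (3 * k) ^ d + (l.1 : Fin k) * (3 * k) ^ d + position d l.2

/-- The set that encodes an input. Both players place the encodings of their inputs for the
subtrees in the middle intervals. For a subtree of depth `d`, the encodings of the two inputs have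
`(2 * k + 1) ^ d` elements together. The owner of the root, whose pointer is `i`, adds `k - i`
times this number of elements to the left, and `i + 1` times this number of elements to the right,
which balances the subtrees on both sides of the one at `i`. -/
def encode : (d : ℕ) → (s : Bool) → Input k d s → Finset ℕ
  | 0, s, _ => if s then {0} else ∅
  | d + 1, true, x => range ((k - (x.1 : Fin k)) * (2 * k + 1) ^ d) ∪
      (blocks ((3 * k) ^ d) (fun j => encode d false (x.2 j)) ∪
        Ico (2 * (k * (3 * k) ^ d))
          (2 * (k * (3 * k) ^ d) + ((x.1 : Fin k) + 1) * (2 * k + 1) ^ d))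
  | d + 1, false, y => blocks ((3 * k) ^ d) (fun j => encode d true (y j))

theorem position_lt : ∀ (d : ℕ) (l : Leaf k d), position d l < (3 * k) ^ d
  | 0, _ => by simp [position]
  | d + 1, l => by
    have h1 := position_lt d l.2
    have h2 : ((l.1 : Fin k) + 1 : ℕ) * (3 * k) ^ d ≤ k * (3 * k) ^ d :=
      Nat.mul_le_mul_right _ (l.1 : Fin k).2
    rw [position, pow_succ]
    linarith [Nat.zero_le (k * (3 * k) ^ d)]

theorem position_injective : ∀ d : ℕ, Function.Injective (position (k := k) d)
  | 0 => fun _ _ _ => rfl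
  | d + 1 => fun l l' h => by
    have key : ∀ l l' : Leaf k (d + 1), position (d + 1) l = position (d + 1) l' →
        ¬ (l.1 : Fin k) < l'.1 := by
      intro l l' h hlt
      have h1 := position_lt d l.2
      have h2 : ((l.1 : Fin k) + 1 : ℕ) * (3 * k) ^ d ≤ (l'.1 : Fin k) * (3 * k) ^ d :=
        Nat.mul_le_mul_right _ hlt
      rw [position, position] at h
      linarith [Nat.zero_le (position d l'.2)]
    have h1 : l.1 = l'.1 := le_antisymm (not_lt.1 (key l' l h.symm)) (not_lt.1 (key l l' h))
    rw [position, position, h1] at h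
    exact Prod.ext h1 (position_injective d (Nat.add_left_cancel h))

theorem two_mul_add_one_pow_le (hk : 0 < k) (d : ℕ) : (2 * k + 1) ^ d ≤ (3 * k) ^ d :=
  Nat.pow_le_pow_left (by omega) d

theorem encode_lt (hk : 0 < k) : ∀ (d : ℕ) (s : Bool) (x : Input k d s), ∀ a ∈ encode d s x,
    a < (3 * k) ^ d
  | 0, s, _, a, ha => by
    rw [encode] at ha
    split_ifs at ha
    · simp [mem_singleton.1 ha]
    · simp at ha
  | d + 1, true, x, a, ha => by
    have hw := two_mul_add_one_pow_le hk d
    rw [pow_succ]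
    rw [encode, mem_union, mem_union, mem_range, mem_Ico] at ha
    rcases ha with ha | ha | ha
    · have : (k - (x.1 : Fin k)) * (2 * k + 1) ^ d ≤ k * (3 * k) ^ d :=
        Nat.mul_le_mul (Nat.sub_le _ _) hw
      linarith [Nat.zero_le (k * (3 * k) ^ d)]
    · have := lt_of_mem_blocks (fun j => encode_lt hk d false (x.2 j)) ha
      linarith [Nat.zero_le (k * (3 * k) ^ d)]
    · have : ((x.1 : Fin k) + 1) * (2 * k + 1) ^ d ≤ k * (3 * k) ^ d :=
        Nat.mul_le_mul (x.1 : Fin k).2 hw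
      linarith
  | d + 1, false, y, a, ha => by
    rw [encode] at ha
    rw [pow_succ]
    have := lt_of_mem_blocks (fun j => encode_lt hk d true (y j)) ha
    linarith [Nat.zero_le (k * (3 * k) ^ d)]

theorem disjoint_encode (hk : 0 < k) (d : ℕ) (x : Input k (d + 1) true) :
    Disjoint (range ((k - (x.1 : Fin k)) * (2 * k + 1) ^ d))
      (blocks ((3 * k) ^ d) (fun j => encode d false (x.2 j)) ∪
        Ico (2 * (k * (3 * k) ^ d))
          (2 * (k * (3 * k) ^ d) + ((x.1 : Fin k) + 1) * (2 * k + 1) ^ d)) ∧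
    Disjoint (blocks ((3 * k) ^ d) (fun j => encode d false (x.2 j)))
      (Ico (2 * (k * (3 * k) ^ d))
        (2 * (k * (3 * k) ^ d) + ((x.1 : Fin k) + 1) * (2 * k + 1) ^ d)) := by
  have h : (k - (x.1 : Fin k)) * (2 * k + 1) ^ d ≤ k * (3 * k) ^ d :=
    Nat.mul_le_mul (Nat.sub_le _ _) (two_mul_add_one_pow_le hk d)
  rw [Finset.disjoint_left, Finset.disjoint_left]
  constructor
  · intro a ha hb
    rw [mem_range] at ha
    rcases mem_union.1 hb with hb | hb
    · have := le_of_mem_blocks hb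
      omega
    · have := (mem_Ico.1 hb).1
      omega
  · intro a ha hb
    have h1 := lt_of_mem_blocks (fun j => encode_lt hk d false (x.2 j)) ha
    have h2 := (mem_Ico.1 hb).1
    omega

theorem card_encode_add_card_encode (hk : 0 < k) : ∀ (d : ℕ) (x : Input k d true)
    (y : Input k d false), #(encode d true x) + #(encode d false y) = (2 * k + 1) ^ d
  | 0, x, y => by simp [encode]
  | d + 1, x, y => by
    obtain ⟨hd1, hd2⟩ := disjoint_encode hk d x
    have hsum : ∑ j, #(encode d false (x.2 j)) + ∑ j, #(encode d true (y j)) =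
        k * (2 * k + 1) ^ d := by
      rw [← sum_add_distrib, sum_congr rfl fun j _ =>
        (add_comm _ _).trans (card_encode_add_card_encode hk d (y j) (x.2 j))]
      simp
    have hi : (k - (x.1 : Fin k)) * (2 * k + 1) ^ d + ((x.1 : Fin k) + 1) * (2 * k + 1) ^ d =
        (k + 1) * (2 * k + 1) ^ d := by
      rw [← add_mul]
      congr 1
      have := (x.1 : Fin k).2
      omega
    rw [encode, encode, card_union_of_disjoint hd1, card_union_of_disjoint hd2,
      card_blocks fun j => encode_lt hk d false (x.2 j),
      card_blocks fun j => encode_lt hk d true (y j), card_range, Nat.card_Ico, pow_succ]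
    have : (2 * k + 1) ^ d * (2 * k + 1) = k * (2 * k + 1) ^ d + (k + 1) * (2 * k + 1) ^ d := by
      ring
    omega

/-- The padding and the subtrees to the left of the chosen child have `k` times the
weight of a subtree together. -/
theorem rankBelow_encode_succ (hk : 0 < k) (d : ℕ) (x : Input k (d + 1) true)
    (y : Input k (d + 1) false) {q : ℕ} (hq : q ≤ (3 * k) ^ d) :
    rankBelow (encode (d + 1) true x) (k * (3 * k) ^ d + (x.1 : Fin k) * (3 * k) ^ d + q) +
      rankBelow (encode (d + 1) false y) (k * (3 * k) ^ d + (x.1 : Fin k) * (3 * k) ^ d + q) =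
    k * (2 * k + 1) ^ d +
      (rankBelow (encode d true (y x.1)) q + rankBelow (encode d false (x.2 x.1)) q) := by
  obtain ⟨hd1, hd2⟩ := disjoint_encode hk d x
  have hi : (k - (x.1 : Fin k)) * (2 * k + 1) ^ d + (x.1 : Fin k) * (2 * k + 1) ^ d =
      k * (2 * k + 1) ^ d := by
    rw [← add_mul, Nat.sub_add_cancel (x.1 : Fin k).2.le]
  have hpad : (k - (x.1 : Fin k)) * (2 * k + 1) ^ d ≤ k * (3 * k) ^ d :=
    Nat.mul_le_mul (Nat.sub_le _ _) (two_mul_add_one_pow_le hk d)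
  have hright : ((x.1 : Fin k) + 1 : ℕ) * (3 * k) ^ d ≤ k * (3 * k) ^ d :=
    Nat.mul_le_mul_right _ (x.1 : Fin k).2
  rw [add_mul] at hright
  have hsum : ∑ j ∈ Iio (x.1 : Fin k), #(encode d false (x.2 j)) +
      ∑ j ∈ Iio (x.1 : Fin k), #(encode d true (y j)) = (x.1 : Fin k) * (2 * k + 1) ^ d := by
    rw [← sum_add_distrib, sum_congr rfl fun j _ =>
      (add_comm _ _).trans (card_encode_add_card_encode hk d (y j) (x.2 j))]
    simp
  have hl : rankBelow (range ((k - (x.1 : Fin k)) * (2 * k + 1) ^ d))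
      (k * (3 * k) ^ d + (x.1 : Fin k) * (3 * k) ^ d + q) =
      (k - (x.1 : Fin k)) * (2 * k + 1) ^ d := by
    rw [rankBelow_eq_card fun a ha => ?_, card_range]
    have := mem_range.1 ha
    omega
  have hr : rankBelow (Ico (2 * (k * (3 * k) ^ d))
      (2 * (k * (3 * k) ^ d) + ((x.1 : Fin k) + 1) * (2 * k + 1) ^ d))
      (k * (3 * k) ^ d + (x.1 : Fin k) * (3 * k) ^ d + q) = 0 := by
    refine rankBelow_eq_zero fun a ha => ?_
    have := (mem_Ico.1 ha).1
    omega
  rw [encode, encode, rankBelow_union hd1, rankBelow_union hd2,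
    rankBelow_blocks (fun j => encode_lt hk d false (x.2 j)) _ hq,
    rankBelow_blocks (fun j => encode_lt hk d true (y j)) _ hq, hl, hr]
  omega

/-- Less than half of the elements lie strictly below the position of the leaf, and more than half
of them weakly below it. -/
theorem two_mul_rankBelow_encode (hk : 0 < k) : ∀ (d : ℕ) (x : Input k d true)
    (y : Input k d false),
    2 * (rankBelow (encode d true x) (position d (leaf d x y)) +
      rankBelow (encode d false y) (position d (leaf d x y))) < (2 * k + 1) ^ d ∧
    (2 * k + 1) ^ d < 2 * (rankBelow (encode d true x) (position d (leaf d x y) + 1) +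
      rankBelow (encode d false y) (position d (leaf d x y) + 1))
  | 0, x, y => by simp [encode, position, rankBelow, filter_singleton]
  | d + 1, x, y => by
    obtain ⟨h1, h2⟩ := two_mul_rankBelow_encode hk d (y x.1) (x.2 x.1)
    have hp := position_lt d (leaf d (y x.1) (x.2 x.1))
    have e1 := rankBelow_encode_succ hk d x y hp.le
    have e2 := rankBelow_encode_succ hk d x y
      (q := position d (leaf d (y x.1) (x.2 x.1)) + 1) hp
    have e3 : position (d + 1) (leaf (d + 1) x y) = k * (3 * k) ^ d +
      (x.1 : Fin k) * (3 * k) ^ d + position d (leaf d (y x.1) (x.2 x.1)) := rfl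
    have e4 : (2 * k + 1) ^ (d + 1) = 2 * (k * (2 * k + 1) ^ d) + (2 * k + 1) ^ d := by ring
    rw [e3, e4, e1, add_assoc _ _ 1, e2]
    omega

/-- The set that encodes an input, as a subset of an ordered universe with `n` elements. -/
def encodeFin (hk : 0 < k) {n d : ℕ} (hn : (3 * k) ^ d ≤ n) (s : Bool) (x : Input k d s) :
    Finset (Fin n) :=
  (encode d s x).attachFin fun a ha => (encode_lt hk d s x a ha).trans_le hn

theorem card_filter_encodeFin (hk : 0 < k) {n d : ℕ} (hn : (3 * k) ^ d ≤ n) (s : Bool)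
    (x : Input k d s) (q : ℕ) :
    #((encodeFin hk hn s x).filter fun a : Fin n => (a : ℕ) < q) = rankBelow (encode d s x) q := by
  rw [rankBelow, ← card_map Fin.valEmbedding]
  congr 1
  ext a
  simp only [Finset.mem_map, mem_filter, encodeFin, mem_attachFin, Fin.valEmbedding_apply]
  constructor
  · rintro ⟨a, h, rfl⟩
    exact h
  · rintro h
    exact ⟨⟨a, (encode_lt hk d s x a h.1).trans_le hn⟩, h, rfl⟩

theorem median_encodeFin (hk : 0 < k) {n d : ℕ} (hn : (3 * k) ^ d ≤ n) (x : Input k d true)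
    (y : Input k d false) :
    median (encodeFin hk hn true x) (encodeFin hk hn false y) =
      some ⟨position d (leaf d x y), (position_lt d _).trans_le hn⟩ := by
  obtain ⟨h1, h2⟩ := two_mul_rankBelow_encode hk d x y
  have hc : #(encodeFin hk hn true x) + #(encodeFin hk hn false y) = (2 * k + 1) ^ d := by
    rw [encodeFin, encodeFin, card_attachFin, card_attachFin, card_encode_add_card_encode hk]
  refine median_eq_some ?_ ?_
  · simp only [Fin.lt_def]
    rwa [hc, card_filter_encodeFin, card_filter_encodeFin]
  · simp only [Fin.le_def, ← Nat.lt_succ_iff]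
    rwa [hc, card_filter_encodeFin, card_filter_encodeFin]

end PointerJumping

/-- In a universe of size `(24 * b + 51) ^ (r + 1)`, the median needs more than `r` rounds of `b`
bits. -/
theorem not_medianHasProtocol {n r b : ℕ} (hn : (3 * (8 * b + 17)) ^ (r + 1) ≤ n) :
    ¬ MedianHasProtocol n r b := by
  rintro ⟨P, hP⟩
  have hk : 0 < 8 * b + 17 := by omega
  refine PointerJumping.not_forall_rounds_le (k := 8 * b + 17) le_rfl (Nat.lt_succ_self r)
    (P.comap (PointerJumping.encodeFin hk hn true) (PointerJumping.encodeFin hk hn false))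
    (fun l => ⟨PointerJumping.position (r + 1) l,
      (PointerJumping.position_lt (r + 1) l).trans_le hn⟩)
    (fun l l' h => PointerJumping.position_injective _ (Fin.mk.inj h)) fun x y => ?_
  have hmed := PointerJumping.median_encodeFin hk hn x y
  rw [Protocol.rounds, Protocol.output_comap, Protocol.transcript_comap]
  obtain ⟨h1, h2, h3⟩ := hP (PointerJumping.encodeFin hk hn true x)
    (PointerJumping.encodeFin hk hn false y) (by
      by_contra h
      rw [not_nonempty_iff_eq_empty, union_eq_empty] at h
      rw [h.1, h.2] at hmed
      simp [median] at hmed)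
  exact ⟨Option.some.inj (h1.symm.trans hmed), h2, h3⟩

/-! ### Asymptotics -/

theorem eventually_pow_le {ε : ℝ} (hε : 0 < ε) {r b : ℕ → ℕ}
    (hr : (fun n : ℕ => (r n : ℝ)) =O[atTop] fun n : ℕ => Real.log n ^ (1 - ε))
    (hb : (fun n : ℕ => (b n : ℝ)) =O[atTop] fun n : ℕ => Real.log n) :
    ∀ᶠ n : ℕ in atTop, (3 * (8 * b n + 17)) ^ (r n + 1) ≤ n := by
  have hlog : Tendsto (fun n : ℕ => Real.log n) atTop atTop :=
    Real.tendsto_log_atTop.comp tendsto_natCast_atTop_atTop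
  -- The summand `1` in `r n + 1` is not `O(log n ^ (1 - ε))` if `1 < ε`.
  set δ : ℝ := min ε 1 with hδ
  have hδ0 : 0 < δ := lt_min hε one_pos
  have hone : ∀ᶠ n : ℕ in atTop, (1 : ℝ) ≤ Real.log n := hlog.eventually_ge_atTop 1
  have hr1 : (fun n : ℕ => (r n : ℝ) + 1) =O[atTop] fun n : ℕ => Real.log n ^ (1 - δ) := by
    refine (hr.trans ?_).add ?_
    · refine IsBigO.of_bound 1 ?_
      filter_upwards [hone] with n hn
      rw [one_mul, Real.norm_of_nonneg (by positivity), Real.norm_of_nonneg (by positivity)]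
      exact Real.rpow_le_rpow_of_exponent_le hn (by linarith [min_le_left ε 1])
    · refine IsBigO.of_bound 1 ?_
      filter_upwards [hone] with n hn
      rw [one_mul, norm_one, Real.norm_of_nonneg (by positivity)]
      exact Real.one_le_rpow hn (by linarith [min_le_right ε 1])
  have hb1 : (fun n : ℕ => Real.log (3 * (8 * b n + 17) : ℕ)) =o[atTop]
      fun n : ℕ => Real.log n ^ δ := by
    obtain ⟨C, hC0, hC⟩ := hb.exists_pos
    have h1 : (fun n : ℕ => Real.log (24 * C + 51) + Real.log (Real.log n)) =o[atTop]
        fun n : ℕ => Real.log n ^ δ := by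
      refine IsLittleO.add ?_ ?_
      · exact isLittleO_const_left.2 (Or.inr
          (tendsto_norm_atTop_atTop.comp ((tendsto_rpow_atTop hδ0).comp hlog)))
      · exact (isLittleO_log_rpow_atTop hδ0).comp_tendsto hlog
    refine IsBigO.trans_isLittleO (IsBigO.of_bound 1 ?_) h1
    filter_upwards [hone, hC.bound] with n hn hbn
    have h2 : (b n : ℝ) ≤ C * Real.log n := by
      rwa [Real.norm_of_nonneg (by positivity), Real.norm_of_nonneg (by positivity)] at hbn
    have h3 : (((3 * (8 * b n + 17) : ℕ)) : ℝ) ≤ (24 * C + 51) * Real.log n := by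
      push_cast
      nlinarith
    rw [one_mul, ← Real.log_mul (by positivity) (by positivity)]
    have h4 : Real.log (3 * (8 * b n + 17) : ℕ) ≤ Real.log ((24 * C + 51) * Real.log n) :=
      Real.log_le_log (by positivity) h3
    have h5 : 0 ≤ Real.log (3 * (8 * b n + 17) : ℕ) := Real.log_natCast_nonneg _
    rwa [Real.norm_of_nonneg h5, Real.norm_of_nonneg (h5.trans h4)]
  have hprod : (fun n : ℕ => ((r n : ℝ) + 1) * Real.log (3 * (8 * b n + 17) : ℕ)) =o[atTop]
      fun n : ℕ => Real.log n := by
    refine (hr1.mul_isLittleO hb1).trans_eventuallyEq ?_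
    filter_upwards [hone] with n hn
    rw [← Real.rpow_add (by linarith), sub_add_cancel, Real.rpow_one]
  filter_upwards [hone, hprod.bound one_pos, eventually_gt_atTop 0] with n hn h hn0
  have hlogn : ((r n : ℝ) + 1) * Real.log (3 * (8 * b n + 17) : ℕ) ≤ Real.log n := by
    rw [one_mul, Real.norm_of_nonneg (by linarith : 0 ≤ Real.log n)] at h
    exact (le_abs_self _).trans h
  have h6 : ((((3 * (8 * b n + 17)) ^ (r n + 1) : ℕ)) : ℝ) ≤ n := by
    rw [← Real.log_le_log_iff (by positivity) (by exact_mod_cast hn0), Nat.cast_pow, Real.log_pow]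
    push_cast at hlogn ⊢
    exact hlogn
  exact_mod_cast h6

theorem theorem2 (ε : ℝ) (hε : 0 < ε) :
    ¬ ∃ r b : ℕ → ℕ,
      (fun n : ℕ => (r n : ℝ)) =O[atTop] (fun n : ℕ => Real.log n ^ (1 - ε)) ∧
      (fun n : ℕ => (b n : ℝ)) =O[atTop] (fun n : ℕ => Real.log n) ∧
      ∀ n : ℕ, 1 ≤ n → MedianHasProtocol n (r n) (b n) := by
  rintro ⟨r, b, hr, hb, h⟩
  obtain ⟨n, hn, hn1⟩ := ((eventually_pow_le hε hr hb).and (eventually_ge_atTop 1)).exists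
  exact not_medianHasProtocol hn (h n hn1)
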